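/- Let $k<m$, let $X\in\mathbb{R}^{m\times n}$, and suppose that the $k$ largest eigenvalues (counted with multiplicity) of $\frac1n XX^\top$ are positive and distinct; write them as $\sigma_1^2>\cdots>\sigma_k^2>0$ with $\sigma_i>0$, and let $U\in\mathbb{R}^{m\times k}$ have corresponding orthonormal eigenvectors as its columns. For $M\in\mathbb{R}^{k\times k}$ let $\mathrm{ut}(M)$ (resp. $\mathrm{lt}(M)$) be the matrix obtained from $M$ by replacing the entries strictly below (resp. strictly above) the diagonal by $0$. Consider on $\mathbb{R}^{k\times m}$ the rotation-only RAG flow $$\dot W=\frac{1}{2n}\bigl(\mathrm{ut}(WXX^\top W^\top)-\mathrm{lt}(WXX^\top W^\top)\bigr)W ,$$ and the orthogonal set $\mathcal{M}=\{OU^\top : O\in\mathbb{R}^{k\times k}\text{ orthogonal}\}$. (1) For every orthogonal $O_0\in\mathbb{R}^{k\times k}$ there is a unique solution $W$ on $[0,\infty)$ with $W(0)=O_0U^\top$. It satisfies $W(t)\in\mathcal{M}$ for all $t\ge 0$, and there is a permutation matrix $P$ with non-zero elements $\pm1$ (a signed permutation matrix) such that $W(t)\to PU^\top$ as $t\to\infty$.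 (2) For every diagonal matrix $\tilde I\in\mathbb{R}^{k\times k}$ with diagonal entries $\pm1$, the point $\tilde IU^\top$ is a locally asymptotically stable equilibrium of the flow on $\mathcal{M}$: it is an equilibrium; for every neighbourhood $N$ of it there is a neighbourhood $N'$ of it such that solutions on $[0,\infty)$ starting in $\mathcal{M}\cap N'$ stay in $N$ for all $t\ge0$; and it has a neighbourhood such that every solution on $[0,\infty)$ starting in the intersection of that neighbourhood with $\mathcal{M}$ converges to it as $t\to\infty$. -/

import Mathlib

open Filter Topology
open scoped Matrix

namespace RAG

/-- Upper triangular part of a square matrix, diagonal included: the entries strictly below the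
diagonal are replaced by `0`. -/
def ut {k : ℕ} (M : Matrix (Fin k) (Fin k) ℝ) : Matrix (Fin k) (Fin k) ℝ :=
  Matrix.of fun i j => if i ≤ j then M i j else 0

/-- Lower triangular part of a square matrix, diagonal included: the entries strictly above the
diagonal are replaced by `0`. -/
def lt {k : ℕ} (M : Matrix (Fin k) (Fin k) ℝ) : Matrix (Fin k) (Fin k) ℝ :=
  Matrix.of fun i j => if j ≤ i then M i j else 0

/-- The data covariance `(1 / n) X Xᵀ`. -/
noncomputable def cov {m n : ℕ} (X : Matrix (Fin m) (Fin n) ℝ) : Matrix (Fin m) (Fin m) ℝ :=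
  (1 / (n : ℝ)) • (X * Xᵀ)

theorem cov_isHermitian {m n : ℕ} (X : Matrix (Fin m) (Fin n) ℝ) : (cov X).IsHermitian := by
  rw [Matrix.IsHermitian, Matrix.conjTranspose_eq_transpose_of_trivial, cov,
    Matrix.transpose_smul, Matrix.transpose_mul, Matrix.transpose_transpose]

/-- The eigenvalues of `(1 / n) X Xᵀ`, repeated according to multiplicity and listed in
decreasing order. -/
noncomputable def covEigenvalues {m n : ℕ} (X : Matrix (Fin m) (Fin n) ℝ) (i : Fin m) : ℝ :=
  (cov_isHermitian X).eigenvalues₀ (Fin.cast (Fintype.card_fin m).symm i)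

/-- `σ₁² > ⋯ > σₖ² > 0` are the `k` largest eigenvalues of `(1 / n) X Xᵀ`, and the columns of `U`
are corresponding orthonormal eigenvectors (the first `k` principal directions). -/
structure IsPrincipal {k m n : ℕ} (hkm : k < m) (X : Matrix (Fin m) (Fin n) ℝ)
    (σ : Fin k → ℝ) (U : Matrix (Fin m) (Fin k) ℝ) : Prop where
  pos : ∀ i, 0 < σ i
  strictAnti : StrictAnti σ
  eigenvalue : ∀ i, covEigenvalues X (Fin.castLE hkm.le i) = σ i ^ 2
  orthonormal : Uᵀ * U = 1
  eigenvector : cov X * U = U * Matrix.diagonal fun i => σ i ^ 2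

/-- The rotation-only RAG vector field
`W ↦ (1 / 2n) (ut (W X Xᵀ Wᵀ) - lt (W X Xᵀ Wᵀ)) W`. -/
noncomputable def ragField {k m n : ℕ} (X : Matrix (Fin m) (Fin n) ℝ)
    (W : Matrix (Fin k) (Fin m) ℝ) : Matrix (Fin k) (Fin m) ℝ :=
  (1 / (2 * (n : ℝ))) • ((ut (W * X * Xᵀ * Wᵀ) - lt (W * X * Xᵀ * Wᵀ)) * W)

/-- `x` solves `ẋ = f x` on `[0, ∞)` (with a one-sided derivative at `0`). -/
def IsSolution {E : Type*} [AddCommGroup E] [Module ℝ E] [TopologicalSpace E]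
    [IsTopologicalAddGroup E] [ContinuousSMul ℝ E] (f : E → E) (x : ℝ → E) : Prop :=
  ∀ t, 0 ≤ t → HasDerivWithinAt x (f (x t)) (Set.Ici 0) t

/-- Local asymptotic stability of the equilibrium `p` of `ẋ = f x`, regarded as a dynamical system
on the state space `M`: `p` is an equilibrium in `M`, it is Lyapunov stable, and it attracts all
solutions that start in `M` close enough to `p`. -/
structure IsAsymptoticallyStable {E : Type*} [AddCommGroup E] [Module ℝ E] [TopologicalSpace E]
    [IsTopologicalAddGroup E] [ContinuousSMul ℝ E] (f : E → E) (M : Set E) (p : E) : Prop where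
  mem : p ∈ M
  equilibrium : f p = 0
  stable : ∀ N ∈ 𝓝 p, ∃ N' ∈ 𝓝 p, ∀ x : ℝ → E, IsSolution f x → x 0 ∈ M → x 0 ∈ N' →
    ∀ t, 0 ≤ t → x t ∈ N
  attractive : ∃ N ∈ 𝓝 p, ∀ x : ℝ → E, IsSolution f x → x 0 ∈ M → x 0 ∈ N →
    Tendsto x atTop (𝓝 p)

/-- The orthogonal set `{O Uᵀ : O orthogonal}`. -/
def orthogonalSet {k m : ℕ} (U : Matrix (Fin m) (Fin k) ℝ) : Set (Matrix (Fin k) (Fin m) ℝ) :=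
  {W | ∃ O ∈ Matrix.orthogonalGroup (Fin k) ℝ, W = O * Uᵀ}

/-- `s` is a vector of signs `±1`. -/
def IsSign {k : ℕ} (s : Fin k → ℝ) : Prop := ∀ i, s i = 1 ∨ s i = -1

/-- Permutation matrices with non-zero entries `±1`. -/
def IsSignedPermutation {k : ℕ} (P : Matrix (Fin k) (Fin k) ℝ) : Prop :=
  ∃ (s : Fin k → ℝ) (π : Equiv.Perm (Fin k)), IsSign s ∧ P = Matrix.diagonal s * π.permMatrix ℝ

end RAG

/-! In the coordinates `O` of `W = O Uᵀ`, with `D = diag d`, `d i = σ i ^ 2` and `A = O D Oᵀ`, the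
flow reads `Ȯ = Ω O`, where `Ω = (ut A - lt A) / 2` is skew because `A` is symmetric
(`ragField_mul_transpose`, `transpose_frameGenerator`). Hence `O` stays orthogonal.

On the orthogonal group, `∑ d i ^ 2 - ∑ d i * A i i` equals half the squared Frobenius norm of `D O
- O D`, so it is nonnegative (`frameEnergy_eq`). Its derivative along the flow is minus a sum of the
`A i j ^ 2` with weights `|d i - d j| / 2`; the signs agree because `d` decreases
(`hasDerivAt_frameEnergy`). Barbalat's lemma drives this dissipation to zero. Its zeros on the group
are orthogonal matrices diagonalizing `D`, thus signed permutations. There are finitely many, so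
each orbit converges to one of them (`exists_tendsto_of_lyapunov`).

The energy vanishes on the group only at sign matrices. These are isolated minima, hence stable, and
a nearby orbit has no other signed permutation within reach as its limit (`frame_solution_stable`).
-/

namespace RAG

/-! ### Topological convergence and confinement of curves in compact sets. -/

section Metric

variable {E : Type*} [MetricSpace E]

/-- A curve that starts inside a sphere and never meets it stays inside. -/
theorem dist_lt_of_forall_dist_ne {x : ℝ → E} (hx : Continuous x) {p : E} {T ε : ℝ}
    (hT : dist (x T) p < ε) (hne : ∀ t, T ≤ t → dist (x t) p ≠ ε) {t : ℝ} (ht : T ≤ t) :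
    dist (x t) p < ε := by
  by_contra! hge
  obtain ⟨s, hs, hs'⟩ := intermediate_value_Icc ht
    (hx.dist (continuous_const (y := p))).continuousOn ⟨hT.le, hge⟩
  exact hne s hs.1 hs'

/-- A continuous curve in a compact set along which `h` tends to `0` converges to a zero of `h`, if
`h` has finitely many zeros on the set. -/
theorem exists_tendsto_of_tendsto_zero {S : Set E} (hS : IsCompact S) {h : E → ℝ}
    (hh : ContinuousOn h S) (hfin : {p ∈ S | h p = 0}.Finite) {x : ℝ → E} (hx : Continuous x)
    (hxS : ∀ t, x t ∈ S) (hlim : Tendsto (fun t => h (x t)) atTop (𝓝 0)) :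
    ∃ p ∈ S, h p = 0 ∧ Tendsto x atTop (𝓝 p) := by
  have habs : Tendsto (fun t => |h (x t)|) atTop (𝓝 0) := by simpa using hlim.abs
  obtain ⟨p, hpS, hp⟩ := hS.exists_mapClusterPt (f := atTop) (u := x)
    (tendsto_principal.2 (Eventually.of_forall hxS))
  have hpx : ∀ N ∈ 𝓝 p, ∃ᶠ t in atTop, x t ∈ N := fun N hN => hp.frequently hN
  have hp0 : h p = 0 := by
    by_contra hne
    have hpos : 0 < |h p| / 2 := by positivity
    obtain ⟨N, hN, hN'⟩ := mem_nhdsWithin_iff_exists_mem_nhds_inter.1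
      ((hh p hpS).abs (lt_mem_nhds (half_lt_self (abs_pos.2 hne))))
    obtain ⟨t, ht, ht'⟩ := ((hpx N hN).and_eventually
      (habs.eventually (gt_mem_nhds hpos))).exists
    have : |h p| / 2 < |h (x t)| := hN' ⟨ht, hxS t⟩
    linarith
  refine ⟨p, hpS, hp0, ?_⟩
  -- Finiteness isolates the cluster point `p` among the zeros: no other lies within `ρ`, so small
  -- spheres around `p` carry no zero of `h`.
  obtain ⟨ρ, hρ, hρ'⟩ := Metric.mem_nhds_iff.1
    ((hfin.subset (Set.sdiff_subset (t := {p}))).isClosed.isOpen_compl.mem_nhds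
      (show p ∈ ({q ∈ S | h q = 0} \ {p})ᶜ by simp))
  rw [Metric.tendsto_atTop]
  intro ε hε
  set r := min (ε / 2) (ρ / 2)
  have hr : 0 < r := by positivity
  have hsph : ∀ q ∈ S ∩ Metric.sphere p r, h q ≠ 0 := by
    rintro q ⟨hqS, hq⟩ hq0
    have hq' : dist q p = r := hq
    refine hρ' (show q ∈ Metric.ball p ρ from ?_) ⟨⟨hqS, hq0⟩, ?_⟩
    · rw [Metric.mem_ball, hq']
      exact (min_le_right _ _).trans_lt (half_lt_self hρ)
    · rintro rfl
      rw [dist_self] at hq'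
      exact hr.ne hq'
  -- On the compact part of the sphere in `S`, `|h|` has a positive minimum, so late times avoid the
  -- sphere. Since `p` is a cluster point, the curve is inside the ball at some later time and is
  -- trapped there.
  obtain ⟨T, hT⟩ : ∃ T, ∀ t, T ≤ t → dist (x t) p ≠ r := by
    by_cases hne : (S ∩ Metric.sphere p r).Nonempty
    · obtain ⟨q, hq, hqmin⟩ := (hS.inter_right Metric.isClosed_sphere).exists_isMinOn hne
        ((hh.mono Set.inter_subset_left).abs)
      obtain ⟨T, hT⟩ := eventually_atTop.1
        (habs.eventually (gt_mem_nhds (abs_pos.2 (hsph q hq))))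
      exact ⟨T, fun t ht hxt => (hT t ht).not_ge (hqmin ⟨hxS t, hxt⟩)⟩
    · exact ⟨0, fun t _ hxt => hne ⟨x t, hxS t, hxt⟩⟩
  obtain ⟨T', hT', hlt⟩ := ((hpx _ (Metric.ball_mem_nhds p hr)).and_eventually
    (eventually_ge_atTop T)).exists
  exact ⟨T', fun t ht => (dist_lt_of_forall_dist_ne hx hT'
    (fun s hs => hT s (hlt.trans hs)) ht).trans_le ((min_le_left _ _).trans (half_le_self hε.le))⟩

/-- Lyapunov stability: sublevel sets of `u` near an isolated zero confine the curves in `S` along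
which `u` does not increase. -/
theorem exists_nhds_forall_dist_lt {S : Set E} (hS : IsCompact S) {u : E → ℝ} (hu : Continuous u)
    (hu0 : ∀ q ∈ S, 0 ≤ u q) {p : E} (hp : u p = 0) {ε : ℝ} (hε : 0 < ε)
    (hiso : ∀ q ∈ S, u q = 0 → dist q p ≠ ε) :
    ∃ N ∈ 𝓝 p, ∀ x : ℝ → E, Continuous x → (∀ t, x t ∈ S) →
      (∀ t, 0 ≤ t → u (x t) ≤ u (x 0)) → x 0 ∈ N → ∀ t, 0 ≤ t → dist (x t) p < ε := by
  obtain ⟨c, hc, hc'⟩ : ∃ c, 0 < c ∧ ∀ q ∈ S, dist q p = ε → c ≤ u q := by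
    by_cases hne : (S ∩ Metric.sphere p ε).Nonempty
    · obtain ⟨q, hq, hqmin⟩ := (hS.inter_right Metric.isClosed_sphere).exists_isMinOn hne
        hu.continuousOn
      exact ⟨u q, (hu0 q hq.1).lt_of_ne fun h => hiso q hq.1 h.symm hq.2,
        fun q' h1 h2 => hqmin ⟨h1, h2⟩⟩
    · exact ⟨1, one_pos, fun q h1 h2 => (hne ⟨q, h1, h2⟩).elim⟩
  refine ⟨Metric.ball p ε ∩ {q | u q < c}, inter_mem (Metric.ball_mem_nhds p hε)
    (hu.continuousAt.eventually (gt_mem_nhds (by rwa [hp]))), ?_⟩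
  rintro x hx hxS hux ⟨h1, h2⟩ t ht
  exact dist_lt_of_forall_dist_ne hx h1 (fun s hs hxs =>
    ((hux s hs).trans_lt h2).not_ge (hc' _ (hxS s) hxs)) ht

end Metric

/-! ### Global existence, uniqueness, Barbalat and LaSalle. -/

section Dynamics

variable {E : Type*} [NormedAddCommGroup E] [NormedSpace ℝ E]

/-- A bounded Lipschitz vector field has global integral curves. -/
theorem exists_global_solution [CompleteSpace E] {f : E → E} {K C : NNReal}
    (hf : LipschitzWith K f) (hC : ∀ x, ‖f x‖ ≤ C) (x₀ : E) :
    ∃ x : ℝ → E, x 0 = x₀ ∧ ∀ t, HasDerivAt x (f (x t)) t := by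
  have hpos : ∀ N : ℕ, (0 : ℝ) < N + 1 := fun N => by positivity
  have hex : ∀ N : ℕ, ∃ α : ℝ → E, α 0 = x₀ ∧ ∀ t ∈ Set.Icc (-((N : ℝ) + 1)) (N + 1),
      HasDerivWithinAt α (f (α t)) (Set.Icc (-((N : ℝ) + 1)) (N + 1)) t := by
    intro N
    have h0 : (0 : ℝ) ∈ Set.Icc (-((N : ℝ) + 1)) (N + 1) :=
      ⟨by linarith [hpos N], (hpos N).le⟩
    -- At speed at most `C`, a curve cannot leave the ball of radius `C * (N + 1)` in time `N + 1`.
    have hPL : IsPicardLindelof (fun _ => f) (⟨0, h0⟩ : Set.Icc (-((N : ℝ) + 1)) (N + 1)) x₀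
        (C * (N + 1)) 0 C K :=
      { lipschitzOnWith := fun t _ => hf.lipschitzOnWith
        continuousOn := fun x _ => continuousOn_const
        norm_le := fun t _ x _ => hC x
        mul_max_le := by simp }
    exact hPL.exists_eq_forall_mem_Icc_hasDerivWithinAt₀
  choose α hα0 hα using hex
  have hagree : ∀ N M : ℕ, N ≤ M → Set.EqOn (α N) (α M) (Set.Icc (-((N : ℝ) + 1)) (N + 1)) := by
    intro N M hNM
    have hNM' : (N : ℝ) ≤ M := by exact_mod_cast hNM
    have hsub : Set.Icc (-((N : ℝ) + 1)) (N + 1) ⊆ Set.Icc (-((M : ℝ) + 1)) (M + 1) :=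
      Set.Icc_subset_Icc (by linarith) (by linarith)
    refine ODE_solution_unique_of_mem_Icc (v := fun _ => f) (s := fun _ => Set.univ) (K := K)
      (t₀ := 0) (fun t _ => hf.lipschitzOnWith) ⟨by linarith [hpos N], hpos N⟩
      (fun t ht => (hα N t ht).continuousWithinAt) ?_ (fun _ _ => trivial)
      (fun t ht => ((hα M t (hsub ht)).mono hsub).continuousWithinAt) ?_ (fun _ _ => trivial)
      (by rw [hα0, hα0])
    · exact fun t ht => (hα N t (Set.Ioo_subset_Icc_self ht)).hasDerivAt (Icc_mem_nhds ht.1 ht.2)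
    · exact fun t ht => ((hα M t (hsub (Set.Ioo_subset_Icc_self ht))).mono hsub).hasDerivAt
        (Icc_mem_nhds ht.1 ht.2)
  have hloc : ∀ (N : ℕ) (t : ℝ), |t| < N + 1 → α ⌈|t|⌉₊ t = α N t := by
    intro N t ht
    have h1 : |t| ≤ ⌈|t|⌉₊ := Nat.le_ceil _
    rcases le_total ⌈|t|⌉₊ N with h | h
    · exact hagree _ _ h (abs_le.1 (by linarith))
    · exact (hagree _ _ h (abs_le.1 ht.le)).symm
  -- The half-width `N + 1` rather than `N` keeps `t` interior to the interval for `N = ⌈|t|⌉₊`, so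
  -- the glued curve has a two-sided derivative.
  refine ⟨fun t => α ⌈|t|⌉₊ t, by simp [hα0], fun t => ?_⟩
  set N := ⌈|t|⌉₊
  have ht : |t| < N + 1 := (Nat.le_ceil _).trans_lt (lt_add_one _)
  have hev : (fun t => α ⌈|t|⌉₊ t) =ᶠ[𝓝 t] α N :=
    (continuous_abs.continuousAt.eventually (gt_mem_nhds ht)).mono fun s hs => hloc N s hs
  have hlt := abs_lt.1 ht
  exact (((hα N t ⟨hlt.1.le, hlt.2.le⟩).hasDerivAt
    (Icc_mem_nhds hlt.1 hlt.2))).congr_of_eventuallyEq hev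

/-- Forward uniqueness for the integral curves of a `C¹` vector field. -/
theorem IsSolution.unique [FiniteDimensional ℝ E] {f : E → E} (hf : ContDiff ℝ 1 f) {x y : ℝ → E}
    (hx : IsSolution f x) (hy : IsSolution f y) (h0 : x 0 = y 0) {t : ℝ} (ht : 0 ≤ t) :
    x t = y t := by
  have hsub : Set.Icc 0 t ⊆ Set.Ici (0 : ℝ) := fun s hs => hs.1
  have hcx : ContinuousOn x (Set.Icc 0 t) := fun s hs =>
    (hx s hs.1).continuousWithinAt.mono hsub
  have hcy : ContinuousOn y (Set.Icc 0 t) := fun s hs =>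
    (hy s hs.1).continuousWithinAt.mono hsub
  -- Both curves stay in one ball up to time `t`, and the field is Lipschitz there.
  obtain ⟨R, hR⟩ := ((isCompact_Icc.image_of_continuousOn hcx).union
    (isCompact_Icc.image_of_continuousOn hcy)).isBounded.subset_closedBall (0 : E)
  have : ProperSpace E := FiniteDimensional.proper ℝ E
  obtain ⟨K, hK⟩ := hf.contDiffOn.exists_lipschitzOnWith one_ne_zero
    (convex_closedBall (0 : E) R) (isCompact_closedBall _ _)
  refine ODE_solution_unique_of_mem_Icc_right (v := fun _ => f)
    (s := fun _ => Metric.closedBall 0 R) (fun _ _ => hK) hcx ?_ ?_ hcy ?_ ?_ h0 ⟨ht, le_rfl⟩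
  · exact fun s hs => (hx s hs.1).mono (Set.Ici_subset_Ici.2 hs.1)
  · exact fun s hs => hR (Or.inl ⟨s, Set.Ico_subset_Icc_self hs, rfl⟩)
  · exact fun s hs => (hy s hs.1).mono (Set.Ici_subset_Ici.2 hs.1)
  · exact fun s hs => hR (Or.inr ⟨s, Set.Ico_subset_Icc_self hs, rfl⟩)

/-- Barbalat's lemma. -/
theorem tendsto_zero_of_uniformContinuousOn {u g : ℝ → ℝ} (hu : ∀ t, HasDerivAt u (-g t) t)
    (hg : ∀ t, 0 ≤ t → 0 ≤ g t) (hpos : ∀ t, 0 ≤ t → 0 ≤ u t)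
    (hgc : UniformContinuousOn g (Set.Ici 0)) : Tendsto g atTop (𝓝 0) := by
  have hmean : ∀ a b : ℝ, a < b → ∃ c ∈ Set.Ioo a b, u a - u b = (b - a) * g c := by
    intro a b hab
    obtain ⟨c, hc, hc'⟩ := exists_hasDerivAt_eq_slope u (fun t => -g t) hab
      (fun t _ => (hu t).continuousAt.continuousWithinAt) (fun t _ => hu t)
    refine ⟨c, hc, ?_⟩
    have : b - a ≠ 0 := by linarith
    field_simp at hc'
    linarith
  have hanti : AntitoneOn u (Set.Ici 0) := by
    intro a ha b _ hab
    rcases hab.eq_or_lt with rfl | hab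
    · exact le_rfl
    · obtain ⟨c, hc, h⟩ := hmean a b hab
      have := mul_nonneg (sub_nonneg.2 hab.le) (hg c ((Set.mem_Ici.1 ha).trans hc.1.le))
      linarith
  obtain ⟨l, hl⟩ : ∃ l, Tendsto u atTop (𝓝 l) := by
    have hanti' : Antitone fun t => u (max t 0) := fun a b hab =>
      hanti (Set.mem_Ici.2 (le_max_right _ _)) (Set.mem_Ici.2 (le_max_right _ _))
        (max_le_max_right _ hab)
    refine ⟨_, (tendsto_atTop_ciInf hanti' ⟨0, ?_⟩).congr' ?_⟩
    · rintro _ ⟨t, rfl⟩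
      exact hpos _ (le_max_right _ _)
    · filter_upwards [eventually_ge_atTop 0] with t ht
      rw [max_eq_left ht]
  rw [Metric.tendsto_nhds]
  intro ε hε
  obtain ⟨δ, hδ, hgδ⟩ := Metric.uniformContinuousOn_iff.1 hgc (ε / 2) (half_pos hε)
  -- Convergence of `u` makes its drop over windows of length `δ / 2` small. The mean value theorem
  -- then gives a point of the window where `g < ε / 2`, and uniform continuity carries the bound
  -- back to `t`.
  have hdiff : Tendsto (fun t => u t - u (t + δ / 2)) atTop (𝓝 0) := by
    simpa using hl.sub (hl.comp (tendsto_atTop_add_const_right atTop (δ / 2) tendsto_id))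
  filter_upwards [hdiff.eventually (gt_mem_nhds (show (0 : ℝ) < δ / 2 * (ε / 2) by positivity)),
    eventually_ge_atTop 0] with t ht ht0
  obtain ⟨c, hc, hc'⟩ := hmean t (t + δ / 2) (by linarith)
  have h1 : g c < ε / 2 := by
    rw [hc', add_sub_cancel_left] at ht
    exact lt_of_mul_lt_mul_left ht (by positivity)
  have h2 := hgδ c (Set.mem_Ici.2 (ht0.trans hc.1.le)) t ht0 (by
    rw [Real.dist_eq, abs_lt]; constructor <;> linarith [hc.1, hc.2])
  rw [Real.dist_eq, abs_lt] at h2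
  rw [Real.dist_eq, sub_zero, abs_of_nonneg (hg t ht0)]
  linarith [h2.1]

/-- LaSalle's principle for a strict Lyapunov function `u` on an invariant compact set `S`, when the
dissipation `h` has finitely many zeros on `S`. -/
theorem exists_tendsto_of_lyapunov {S : Set E} (hS : IsCompact S) {f : E → E}
    (hf : ContinuousOn f S) {u h : E → ℝ} (hh : ContinuousOn h S) (hu0 : ∀ p ∈ S, 0 ≤ u p)
    (hh0 : ∀ p ∈ S, 0 ≤ h p) (hfin : {p ∈ S | h p = 0}.Finite) {x : ℝ → E}
    (hx : ∀ t, HasDerivAt x (f (x t)) t) (hxS : ∀ t, x t ∈ S)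
    (hux : ∀ t, HasDerivAt (fun t => u (x t)) (-h (x t)) t) :
    ∃ p ∈ S, h p = 0 ∧ Tendsto x atTop (𝓝 p) := by
  have hxc : Continuous x := continuous_iff_continuousAt.2 fun t => (hx t).continuousAt
  refine exists_tendsto_of_tendsto_zero hS hh hfin hxc hxS
    (tendsto_zero_of_uniformContinuousOn hux (fun t _ => hh0 _ (hxS t))
      (fun t _ => hu0 _ (hxS t)) ?_)
  -- Bounded speed on `S` makes the curve Lipschitz, which supplies the uniform continuity needed
  -- for Barbalat.
  obtain ⟨C, hC⟩ := hS.exists_bound_of_continuousOn hf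
  have hlip : LipschitzWith C.toNNReal x := lipschitzWith_of_nnnorm_deriv_le
    (fun t => (hx t).differentiableAt) (fun t => by
      rw [(hx t).deriv, ← NNReal.coe_le_coe, coe_nnnorm]
      exact (hC _ (hxS t)).trans (Real.le_coe_toNNReal C))
  exact (hS.uniformContinuousOn_of_continuous hh).comp hlip.uniformContinuous.uniformContinuousOn
    (fun t _ => hxS t)

end Dynamics

/-! ### Entrywise calculus for matrices and the orthogonal group. -/

section MatrixCalculus

open scoped Matrix.Norms.Elementwise

variable {E : Type*} [NormedAddCommGroup E] [NormedSpace ℝ E] {k m n : ℕ}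

theorem contDiff_matrix {f : E → Matrix (Fin m) (Fin n) ℝ}
    (hf : ∀ i j, ContDiff ℝ 1 fun x => f x i j) : ContDiff ℝ 1 f :=
  contDiff_pi.2 fun i => contDiff_pi.2 fun j => hf i j

theorem contDiff_matrix_entry {f : E → Matrix (Fin m) (Fin n) ℝ} (hf : ContDiff ℝ 1 f)
    (i : Fin m) (j : Fin n) : ContDiff ℝ 1 fun x => f x i j :=
  contDiff_pi.1 (contDiff_pi.1 hf i) j

theorem contDiff_matrix_mul {f : E → Matrix (Fin k) (Fin m) ℝ} {g : E → Matrix (Fin m) (Fin n) ℝ}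
    (hf : ContDiff ℝ 1 f) (hg : ContDiff ℝ 1 g) : ContDiff ℝ 1 fun x => f x * g x :=
  contDiff_matrix fun i j => by
    simp only [Matrix.mul_apply]
    exact ContDiff.sum fun l _ => (contDiff_matrix_entry hf i l).mul (contDiff_matrix_entry hg l j)

theorem contDiff_matrix_transpose {f : E → Matrix (Fin m) (Fin n) ℝ} (hf : ContDiff ℝ 1 f) :
    ContDiff ℝ 1 fun x => (f x)ᵀ :=
  contDiff_matrix fun i j => contDiff_matrix_entry hf j i

theorem contDiff_ut {f : E → Matrix (Fin k) (Fin k) ℝ} (hf : ContDiff ℝ 1 f) :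
    ContDiff ℝ 1 fun x => ut (f x) :=
  contDiff_matrix fun i j => by
    by_cases h : i ≤ j
    · simpa [ut, h] using contDiff_matrix_entry hf i j
    · simpa [ut, h] using contDiff_const

theorem contDiff_lt {f : E → Matrix (Fin k) (Fin k) ℝ} (hf : ContDiff ℝ 1 f) :
    ContDiff ℝ 1 fun x => lt (f x) :=
  contDiff_matrix fun i j => by
    by_cases h : j ≤ i
    · simpa [lt, h] using contDiff_matrix_entry hf i j
    · simpa [lt, h] using contDiff_const

theorem contDiff_ragField (X : Matrix (Fin m) (Fin n) ℝ) :
    ContDiff ℝ 1 (ragField (k := k) X) := by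
  have h : ContDiff ℝ 1 fun W : Matrix (Fin k) (Fin m) ℝ => W * X * Xᵀ * Wᵀ :=
    contDiff_matrix_mul (contDiff_matrix_mul (contDiff_matrix_mul contDiff_id contDiff_const)
      contDiff_const) (contDiff_matrix_transpose contDiff_id)
  exact (contDiff_matrix_mul ((contDiff_ut h).sub (contDiff_lt h)) contDiff_id).const_smul _

theorem hasDerivAt_matrix {f : ℝ → Matrix (Fin m) (Fin n) ℝ} {f' : Matrix (Fin m) (Fin n) ℝ}
    {t : ℝ} : HasDerivAt f f' t ↔ ∀ i j, HasDerivAt (fun s => f s i j) (f' i j) t :=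
  hasDerivAt_pi.trans (forall_congr' fun _ => hasDerivAt_pi)

theorem hasDerivAt_matrix_mul {f : ℝ → Matrix (Fin k) (Fin m) ℝ} {g : ℝ → Matrix (Fin m) (Fin n) ℝ}
    {f' : Matrix (Fin k) (Fin m) ℝ} {g' : Matrix (Fin m) (Fin n) ℝ} {t : ℝ}
    (hf : HasDerivAt f f' t) (hg : HasDerivAt g g' t) :
    HasDerivAt (fun s => f s * g s) (f' * g t + f t * g') t :=
  hasDerivAt_matrix.2 fun i j => by
    simp only [Matrix.mul_apply, Matrix.add_apply, ← Finset.sum_add_distrib]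
    exact HasDerivAt.fun_sum fun l _ => (hasDerivAt_matrix.1 hf i l).mul (hasDerivAt_matrix.1 hg l j)

/-- A rotating frame stays orthogonal. -/
theorem mem_orthogonalGroup_of_hasDerivAt {Ω O : ℝ → Matrix (Fin k) (Fin k) ℝ}
    (hΩ : ∀ t, (Ω t)ᵀ = -Ω t) (hO : ∀ t, HasDerivAt O (Ω t * O t) t)
    (h0 : O 0 ∈ Matrix.orthogonalGroup (Fin k) ℝ) (t : ℝ) :
    O t ∈ Matrix.orthogonalGroup (Fin k) ℝ := by
  rw [Matrix.mem_orthogonalGroup_iff'] at h0 ⊢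
  have hder : ∀ s, HasDerivAt (fun s => (O s)ᵀ * O s) 0 s := fun s => by
    have hT : HasDerivAt (fun s => (O s)ᵀ) (Ω s * O s)ᵀ s :=
      hasDerivAt_matrix.2 fun i j => hasDerivAt_matrix.1 (hO s) j i
    have := hasDerivAt_matrix_mul hT (hO s)
    rwa [Matrix.transpose_mul, hΩ, Matrix.mul_neg, Matrix.neg_mul, Matrix.mul_assoc,
      neg_add_cancel] at this
  rw [← h0]
  exact is_const_of_deriv_eq_zero (fun s => (hder s).differentiableAt) (fun s => (hder s).deriv) t 0

theorem isCompact_orthogonalGroup :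
    IsCompact (Matrix.orthogonalGroup (Fin k) ℝ : Set (Matrix (Fin k) (Fin k) ℝ)) := by
  have hcl : IsClosed {O : Matrix (Fin k) (Fin k) ℝ | O * Oᵀ = 1} :=
    isClosed_eq (contDiff_matrix_mul contDiff_id
      (contDiff_matrix_transpose contDiff_id)).continuous continuous_const
  refine (isCompact_closedBall (0 : Matrix (Fin k) (Fin k) ℝ) 1).of_isClosed_subset ?_ fun O hO => ?_
  · have h : (Matrix.orthogonalGroup (Fin k) ℝ : Set (Matrix (Fin k) (Fin k) ℝ)) =
        {O | O * Oᵀ = 1} := Set.ext fun O => Matrix.mem_orthogonalGroup_iff _ _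
    rwa [h]
  · rw [mem_closedBall_zero_iff]
    exact entrywise_sup_norm_bound_of_unitary hO

end MatrixCalculus

/-! ### The rotation flow on the orthogonal group. -/

section RotationFlow

variable {k : ℕ}

/-- The quadratic form of `diag d` in the frame given by the rows of `O`. -/
def frameForm (d : Fin k → ℝ) (O : Matrix (Fin k) (Fin k) ℝ) : Matrix (Fin k) (Fin k) ℝ :=
  O * Matrix.diagonal d * Oᵀ

/-- The infinitesimal rotation that generates the flow at `O`. -/
noncomputable def frameGenerator (d : Fin k → ℝ) (O : Matrix (Fin k) (Fin k) ℝ) :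
    Matrix (Fin k) (Fin k) ℝ :=
  (1 / 2 : ℝ) • (ut (frameForm d O) - lt (frameForm d O))

/-- The rotation flow in the coordinates `O` of `W = O Uᵀ`. -/
noncomputable def frameField (d : Fin k → ℝ) (O : Matrix (Fin k) (Fin k) ℝ) :
    Matrix (Fin k) (Fin k) ℝ :=
  frameGenerator d O * O

/-- The Lyapunov function of the rotation flow. -/
def frameEnergy (d : Fin k → ℝ) (O : Matrix (Fin k) (Fin k) ℝ) : ℝ :=
  ∑ i, d i ^ 2 - ∑ i, d i * frameForm d O i i

/-- The dissipation of `frameEnergy` along the rotation flow. -/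
noncomputable def frameDissipation (d : Fin k → ℝ) (O : Matrix (Fin k) (Fin k) ℝ) : ℝ :=
  ∑ i, ∑ j, |d i - d j| / 2 * frameForm d O i j ^ 2

theorem frameForm_apply (d : Fin k → ℝ) (O : Matrix (Fin k) (Fin k) ℝ) (i j : Fin k) :
    frameForm d O i j = ∑ l, d l * (O i l * O j l) := by
  rw [frameForm, Matrix.mul_apply]
  refine Finset.sum_congr rfl fun l _ => ?_
  rw [Matrix.mul_diagonal, Matrix.transpose_apply]
  ring

theorem frameForm_comm (d : Fin k → ℝ) (O : Matrix (Fin k) (Fin k) ℝ) (i j : Fin k) :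
    frameForm d O i j = frameForm d O j i := by
  simp only [frameForm_apply, mul_comm (O i _)]

theorem frameGenerator_apply (d : Fin k → ℝ) (O : Matrix (Fin k) (Fin k) ℝ) (i j : Fin k) :
    frameGenerator d O i j =
      ((if i ≤ j then 1 else 0) - (if j ≤ i then 1 else 0)) / 2 * frameForm d O i j := by
  simp only [frameGenerator, ut, lt, Matrix.smul_apply, Matrix.sub_apply, Matrix.of_apply,
    smul_eq_mul]
  split_ifs <;> ring

theorem transpose_frameGenerator (d : Fin k → ℝ) (O : Matrix (Fin k) (Fin k) ℝ) :
    (frameGenerator d O)ᵀ = -frameGenerator d O := by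
  ext i j
  rw [Matrix.transpose_apply, Matrix.neg_apply, frameGenerator_apply, frameGenerator_apply,
    frameForm_comm]
  ring

theorem frameDissipation_nonneg (d : Fin k → ℝ) (O : Matrix (Fin k) (Fin k) ℝ) :
    0 ≤ frameDissipation d O :=
  Finset.sum_nonneg fun _ _ => Finset.sum_nonneg fun _ _ => by positivity

theorem sum_sq_row {O : Matrix (Fin k) (Fin k) ℝ} (hO : O ∈ Matrix.orthogonalGroup (Fin k) ℝ)
    (i : Fin k) : ∑ l, O i l ^ 2 = 1 := by
  have h := congr_fun₂ ((Matrix.mem_orthogonalGroup_iff _ _).1 hO) i i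
  simpa [Matrix.mul_apply, ← sq] using h

theorem sum_sq_column {O : Matrix (Fin k) (Fin k) ℝ} (hO : O ∈ Matrix.orthogonalGroup (Fin k) ℝ)
    (l : Fin k) : ∑ i, O i l ^ 2 = 1 := by
  have h := congr_fun₂ ((Matrix.mem_orthogonalGroup_iff' _ _).1 hO) l l
  simpa [Matrix.mul_apply, ← sq] using h

/-- Unit rows and columns let `∑ d i ^ 2` be written twice as a sum weighted by `O i l ^ 2`, which
completes the square. -/
theorem frameEnergy_eq (d : Fin k → ℝ) {O : Matrix (Fin k) (Fin k) ℝ}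
    (hO : O ∈ Matrix.orthogonalGroup (Fin k) ℝ) :
    frameEnergy d O = ∑ i, ∑ l, O i l ^ 2 * (d i - d l) ^ 2 / 2 := by
  have h1 : ∑ i, ∑ l, O i l ^ 2 * d i ^ 2 = ∑ i, d i ^ 2 :=
    Finset.sum_congr rfl fun i _ => by rw [← Finset.sum_mul, sum_sq_row hO, one_mul]
  have h2 : ∑ i, ∑ l, O i l ^ 2 * d l ^ 2 = ∑ i, d i ^ 2 := by
    rw [Finset.sum_comm]
    exact Finset.sum_congr rfl fun i _ => by rw [← Finset.sum_mul, sum_sq_column hO, one_mul]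
  have h3 : ∑ i, d i * frameForm d O i i = ∑ i, ∑ l, O i l ^ 2 * (d i * d l) :=
    Finset.sum_congr rfl fun i _ => by
      rw [frameForm_apply, Finset.mul_sum]
      exact Finset.sum_congr rfl fun l _ => by ring
  have h4 : ∑ i, ∑ l, O i l ^ 2 * (d i - d l) ^ 2 / 2 =
      (∑ i, ∑ l, O i l ^ 2 * d i ^ 2 + ∑ i, ∑ l, O i l ^ 2 * d l ^ 2) / 2
        - ∑ i, ∑ l, O i l ^ 2 * (d i * d l) := by
    simp only [← Finset.sum_add_distrib, Finset.sum_div, ← Finset.sum_sub_distrib]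
    exact Finset.sum_congr rfl fun i _ => Finset.sum_congr rfl fun l _ => by ring
  rw [h4, h1, h2, frameEnergy, h3]
  ring

theorem frameEnergy_nonneg (d : Fin k → ℝ) {O : Matrix (Fin k) (Fin k) ℝ}
    (hO : O ∈ Matrix.orthogonalGroup (Fin k) ℝ) : 0 ≤ frameEnergy d O := by
  rw [frameEnergy_eq d hO]
  exact Finset.sum_nonneg fun _ _ => Finset.sum_nonneg fun _ _ => by positivity

/-- Off-diagonal entries vanish on the zero set of the energy. -/
theorem apply_eq_zero_of_frameEnergy_eq_zero {d : Fin k → ℝ} (hd : Function.Injective d)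
    {O : Matrix (Fin k) (Fin k) ℝ} (hO : O ∈ Matrix.orthogonalGroup (Fin k) ℝ)
    (h : frameEnergy d O = 0) {i l : Fin k} (hil : i ≠ l) : O i l = 0 := by
  rw [frameEnergy_eq d hO, Finset.sum_eq_zero_iff_of_nonneg
    fun _ _ => Finset.sum_nonneg fun _ _ => by positivity] at h
  have h1 := h i (Finset.mem_univ i)
  rw [Finset.sum_eq_zero_iff_of_nonneg fun _ _ => by positivity] at h1
  have h2 := h1 l (Finset.mem_univ l)
  have h3 : d i - d l ≠ 0 := sub_ne_zero.2 (hd.ne hil)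
  simpa [h3] using h2

theorem frameForm_eq_zero_of_frameDissipation_eq_zero {d : Fin k → ℝ} (hd : Function.Injective d)
    {O : Matrix (Fin k) (Fin k) ℝ} (h : frameDissipation d O = 0) {i j : Fin k} (hij : i ≠ j) :
    frameForm d O i j = 0 := by
  rw [frameDissipation, Finset.sum_eq_zero_iff_of_nonneg
    fun _ _ => Finset.sum_nonneg fun _ _ => by positivity] at h
  have h1 := h i (Finset.mem_univ i)
  rw [Finset.sum_eq_zero_iff_of_nonneg fun _ _ => by positivity] at h1
  have h2 := h1 j (Finset.mem_univ j)
  have h3 : d i - d j ≠ 0 := sub_ne_zero.2 (hd.ne hij)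
  simpa [h3] using h2

/-- An orthogonal matrix that diagonalizes `diag d` is a signed permutation matrix. -/
theorem isSignedPermutation_of_frameDissipation_eq_zero {d : Fin k → ℝ}
    (hd : Function.Injective d) {O : Matrix (Fin k) (Fin k) ℝ}
    (hO : O ∈ Matrix.orthogonalGroup (Fin k) ℝ) (h : frameDissipation d O = 0) :
    IsSignedPermutation O := by
  have hOO := (Matrix.mem_orthogonalGroup_iff _ _).1 hO
  have hcomm : frameForm d O * O = O * Matrix.diagonal d := by
    rw [frameForm, Matrix.mul_assoc, (Matrix.mem_orthogonalGroup_iff' _ _).1 hO, Matrix.mul_one]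
  -- With `A` diagonal, `A O = O D` reads `A i i * O i l = O i l * d l`. As `d` is injective, each
  -- row has a single nonzero entry.
  have heig : ∀ i l, O i l ≠ 0 → d l = frameForm d O i i := fun i l hil => by
    have h1 := congr_fun₂ hcomm i l
    rw [Matrix.mul_apply, Matrix.mul_diagonal, Finset.sum_eq_single i
      (fun j _ hj => by rw [frameForm_eq_zero_of_frameDissipation_eq_zero hd h hj.symm, zero_mul])
      (by simp), mul_comm] at h1
    exact (mul_left_cancel₀ hil h1).symm
  have hex : ∀ i, ∃ l, O i l ≠ 0 := fun i => by
    by_contra! hz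
    simpa [hz] using sum_sq_row hO i
  choose π hπ using hex
  have hzero : ∀ i l, l ≠ π i → O i l = 0 := fun i l hl => by
    by_contra hne
    exact hl (hd ((heig i l hne).trans (heig i _ (hπ i)).symm))
  have hinj : Function.Injective π := fun i j hij => by
    by_contra hne
    have h1 := congr_fun₂ hOO i j
    rw [Matrix.mul_apply, Matrix.one_apply_ne hne, Finset.sum_eq_single (π i)
      (fun l _ hl => by rw [hzero i l hl, zero_mul]) (by simp), Matrix.transpose_apply] at h1
    exact mul_ne_zero (hπ i) (hij ▸ hπ j) h1
  refine ⟨fun i => O i (π i), Equiv.ofBijective π (Finite.injective_iff_bijective.1 hinj),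
    fun i => ?_, ?_⟩
  · have h1 := sum_sq_row hO i
    rw [Finset.sum_eq_single (π i) (fun l _ hl => by rw [hzero i l hl, sq, zero_mul])
      (by simp)] at h1
    exact sq_eq_sq_iff_eq_or_eq_neg.1 (h1.trans (one_pow 2).symm)
  · ext i l
    rw [Matrix.diagonal_mul, Equiv.Perm.permMatrix, Equiv.toPEquiv, PEquiv.toMatrix_apply]
    by_cases hl : l = π i
    · simp [hl]
    · simp [hzero i l hl, Ne.symm hl]

theorem finite_isSignedPermutation :
    {P : Matrix (Fin k) (Fin k) ℝ | IsSignedPermutation P}.Finite := by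
  have hs : {s : Fin k → ℝ | IsSign s}.Finite := by
    refine (Set.Finite.pi' (t := fun _ : Fin k => ({1, -1} : Set ℝ)) fun _ => Set.toFinite _).subset
      fun s hs i => ?_
    simpa using hs i
  refine (hs.image2 (fun s (π : Equiv.Perm (Fin k)) => Matrix.diagonal s * π.permMatrix ℝ)
    (Set.finite_univ)).subset ?_
  rintro P ⟨s, π, hs, rfl⟩
  exact ⟨s, hs, π, trivial, rfl⟩

theorem diagonal_mem_orthogonalGroup {s : Fin k → ℝ} (hs : IsSign s) :
    Matrix.diagonal s ∈ Matrix.orthogonalGroup (Fin k) ℝ := by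
  rw [Matrix.mem_orthogonalGroup_iff, Matrix.diagonal_transpose, Matrix.diagonal_mul_diagonal,
    ← Matrix.diagonal_one]
  congr 1
  ext i
  rcases hs i with h | h <;> simp [h]

theorem frameForm_diagonal (d : Fin k → ℝ) {s : Fin k → ℝ} (hs : IsSign s) :
    frameForm d (Matrix.diagonal s) = Matrix.diagonal d := by
  rw [frameForm, Matrix.diagonal_transpose, Matrix.diagonal_mul_diagonal,
    Matrix.diagonal_mul_diagonal]
  congr 1
  ext i
  rcases hs i with h | h <;> simp [h]

theorem frameField_diagonal (d : Fin k → ℝ) {s : Fin k → ℝ} (hs : IsSign s) :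
    frameField d (Matrix.diagonal s) = 0 := by
  have h : frameGenerator d (Matrix.diagonal s) = 0 := by
    ext i j
    rw [frameGenerator_apply, frameForm_diagonal d hs]
    rcases eq_or_ne i j with rfl | hij
    · simp
    · simp [Matrix.diagonal_apply_ne _ hij]
  rw [frameField, h, Matrix.zero_mul]

theorem frameEnergy_diagonal (d : Fin k → ℝ) {s : Fin k → ℝ} (hs : IsSign s) :
    frameEnergy d (Matrix.diagonal s) = 0 := by
  simp [frameEnergy, frameForm_diagonal d hs, sq]

theorem frameDissipation_eq_zero_of_frameEnergy_eq_zero {d : Fin k → ℝ}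
    (hd : Function.Injective d) {O : Matrix (Fin k) (Fin k) ℝ}
    (hO : O ∈ Matrix.orthogonalGroup (Fin k) ℝ) (h : frameEnergy d O = 0) :
    frameDissipation d O = 0 := by
  refine Finset.sum_eq_zero fun i _ => Finset.sum_eq_zero fun j _ => ?_
  rcases eq_or_ne i j with rfl | hij
  · simp
  · have : frameForm d O i j = 0 := by
      rw [frameForm_apply]
      refine Finset.sum_eq_zero fun l _ => ?_
      rcases eq_or_ne i l with rfl | hil
      · rw [apply_eq_zero_of_frameEnergy_eq_zero hd hO h hij.symm, mul_zero, mul_zero]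
      · rw [apply_eq_zero_of_frameEnergy_eq_zero hd hO h hil, zero_mul, mul_zero]
    rw [this]
    simp

open scoped Matrix.Norms.Elementwise

theorem contDiff_frameForm (d : Fin k → ℝ) : ContDiff ℝ 1 (frameForm d) :=
  contDiff_matrix_mul (contDiff_matrix_mul contDiff_id contDiff_const)
    (contDiff_matrix_transpose contDiff_id)

theorem contDiff_frameField (d : Fin k → ℝ) : ContDiff ℝ 1 (frameField d) :=
  contDiff_matrix_mul (((contDiff_ut (contDiff_frameForm d)).sub
    (contDiff_lt (contDiff_frameForm d))).const_smul _) contDiff_id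

theorem continuous_frameEnergy (d : Fin k → ℝ) : Continuous (frameEnergy d) :=
  continuous_const.sub (continuous_finsetSum _ fun i _ =>
    continuous_const.mul (contDiff_matrix_entry (contDiff_frameForm d) i i).continuous)

theorem continuous_frameDissipation (d : Fin k → ℝ) : Continuous (frameDissipation d) :=
  continuous_finsetSum _ fun i _ => continuous_finsetSum _ fun j _ =>
    continuous_const.mul ((contDiff_matrix_entry (contDiff_frameForm d) i j).continuous.pow 2)

/-- Since `Ȧ = Ω A - A Ω`, the derivative of `A i i` is `∑ j, τ i j * A i j ^ 2`, with `τ` the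
antisymmetric sign of `j - i`. Exchanging `i` and `j` turns the weight `d i * τ i j` into `(d i - d
j) * τ i j / 2`. -/
theorem hasDerivAt_frameEnergy {d : Fin k → ℝ} (hd : StrictAnti d)
    {O : ℝ → Matrix (Fin k) (Fin k) ℝ} {t : ℝ} (hO : HasDerivAt O (frameField d (O t)) t) :
    HasDerivAt (fun s => frameEnergy d (O s)) (-frameDissipation d (O t)) t := by
  set A := frameForm d (O t)
  let τ : Fin k → Fin k → ℝ := fun i j => (if i ≤ j then 1 else 0) - (if j ≤ i then 1 else 0)
  have hA : ∀ i, HasDerivAt (fun s => frameForm d (O s) i i) (∑ j, τ i j * A i j ^ 2) t := by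
    intro i
    simp only [frameForm_apply]
    have h1 : HasDerivAt (fun s => ∑ l, d l * (O s i l * O s i l))
        (∑ l, d l * (frameField d (O t) i l * O t i l + O t i l * frameField d (O t) i l)) t :=
      HasDerivAt.fun_sum fun l _ =>
        ((hasDerivAt_matrix.1 hO i l).mul (hasDerivAt_matrix.1 hO i l)).const_mul (d l)
    convert h1 using 1
    have h2 : ∀ l, d l * (frameField d (O t) i l * O t i l + O t i l * frameField d (O t) i l) =
        ∑ j, τ i j * A i j * (d l * (O t i l * O t j l)) := fun l => by
      rw [frameField, Matrix.mul_apply, Finset.sum_mul, Finset.mul_sum, ← Finset.sum_add_distrib,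
        Finset.mul_sum]
      refine Finset.sum_congr rfl fun j _ => ?_
      rw [frameGenerator_apply]
      simp only [τ, A]
      ring
    rw [Finset.sum_congr rfl fun l _ => h2 l, Finset.sum_comm]
    refine Finset.sum_congr rfl fun j _ => ?_
    rw [← Finset.mul_sum, ← frameForm_apply]
    ring
  have hsum : HasDerivAt (fun s => frameEnergy d (O s)) (-∑ i, d i * ∑ j, τ i j * A i j ^ 2) t :=
    (HasDerivAt.fun_sum fun i _ => (hA i).const_mul (d i)).const_sub _
  convert hsum using 2
  have hanti : ∑ i, ∑ j, d i * (τ i j * A i j ^ 2) = ∑ i, ∑ j, -(d j * (τ i j * A i j ^ 2)) := by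
    rw [Finset.sum_comm]
    refine Finset.sum_congr rfl fun i _ => Finset.sum_congr rfl fun j _ => ?_
    rw [show A j i = A i j from frameForm_comm _ _ _ _]
    simp only [τ]
    ring
  have hhalf : ∑ i, ∑ j, d i * (τ i j * A i j ^ 2) =
      ∑ i, ∑ j, (d i - d j) * τ i j / 2 * A i j ^ 2 := by
    have : ∑ i, ∑ j, (d i - d j) * τ i j / 2 * A i j ^ 2 =
        (∑ i, ∑ j, d i * (τ i j * A i j ^ 2) + ∑ i, ∑ j, -(d j * (τ i j * A i j ^ 2))) / 2 := by
      simp only [← Finset.sum_add_distrib, Finset.sum_div]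
      exact Finset.sum_congr rfl fun i _ => Finset.sum_congr rfl fun j _ => by ring
    rw [this, ← hanti]
    ring
  simp only [Finset.mul_sum]
  rw [hhalf, frameDissipation]
  refine Finset.sum_congr rfl fun i _ => Finset.sum_congr rfl fun j _ => ?_
  have : |d i - d j| = (d i - d j) * τ i j := by
    rcases lt_trichotomy i j with hij | rfl | hij
    · simp [τ, hij.le, hij.not_ge, abs_of_pos (sub_pos.2 (hd hij))]
    · simp
    · simp [τ, hij.le, hij.not_ge, abs_of_neg (sub_neg.2 (hd hij))]
  rw [this]

/-- The rotation flow is complete on the orthogonal group. -/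
theorem exists_frame_solution (d : Fin k → ℝ) {O₀ : Matrix (Fin k) (Fin k) ℝ}
    (h₀ : O₀ ∈ Matrix.orthogonalGroup (Fin k) ℝ) :
    ∃ O : ℝ → Matrix (Fin k) (Fin k) ℝ, O 0 = O₀ ∧
      (∀ t, O t ∈ Matrix.orthogonalGroup (Fin k) ℝ) ∧
      ∀ t, HasDerivAt O (frameField d (O t)) t := by
  -- The cutoff makes the field bounded and Lipschitz but only rescales the skew generator, so
  -- orbits remain orthogonal. Orthogonal matrices have entries of size at most `1`, where `χ = 1`;
  -- the cutoff is thus invisible.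
  let χ : ContDiffBump (0 : Matrix (Fin k) (Fin k) ℝ) := ⟨1, 2, one_pos, one_lt_two⟩
  have hcs : HasCompactSupport fun O => χ O • frameField d O := χ.hasCompactSupport.smul_right
  have hcd : ContDiff ℝ 1 fun O => χ O • frameField d O := χ.contDiff.smul (contDiff_frameField d)
  obtain ⟨K, hK⟩ := hcd.lipschitzWith_of_hasCompactSupport hcs one_ne_zero
  obtain ⟨C, hC⟩ := hcs.exists_bound_of_continuous hcd.continuous
  obtain ⟨O, hO0, hO⟩ := exists_global_solution hK (C := C.toNNReal)
    (fun x => (hC x).trans (Real.le_coe_toNNReal C)) O₀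
  have horth : ∀ t, O t ∈ Matrix.orthogonalGroup (Fin k) ℝ :=
    mem_orthogonalGroup_of_hasDerivAt (Ω := fun t => χ (O t) • frameGenerator d (O t))
      (fun t => by rw [Matrix.transpose_smul, transpose_frameGenerator, smul_neg])
      (fun t => by rw [Matrix.smul_mul]; exact hO t) (by rwa [hO0])
  refine ⟨O, hO0, horth, fun t => ?_⟩
  have h1 : χ (O t) = 1 := χ.one_of_mem_closedBall
    (mem_closedBall_zero_iff.2 (entrywise_sup_norm_bound_of_unitary (horth t)))
  have h2 := hO t
  simp only [h1, one_smul] at h2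
  exact h2

theorem frame_solution_tendsto {d : Fin k → ℝ} (hd : StrictAnti d)
    {O : ℝ → Matrix (Fin k) (Fin k) ℝ} (hO : ∀ t, O t ∈ Matrix.orthogonalGroup (Fin k) ℝ)
    (hO' : ∀ t, HasDerivAt O (frameField d (O t)) t) :
    ∃ P, IsSignedPermutation P ∧ Tendsto O atTop (𝓝 P) := by
  obtain ⟨P, hP, hP0, hlim⟩ := exists_tendsto_of_lyapunov isCompact_orthogonalGroup
    (contDiff_frameField d).continuous.continuousOn
    (continuous_frameDissipation d).continuousOn (fun O hO => frameEnergy_nonneg d hO)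
    (fun O _ => frameDissipation_nonneg d O)
    (finite_isSignedPermutation.subset fun O hO =>
      isSignedPermutation_of_frameDissipation_eq_zero hd.injective hO.1 hO.2)
    hO' hO (fun t => hasDerivAt_frameEnergy hd (hO' t))
  exact ⟨P, isSignedPermutation_of_frameDissipation_eq_zero hd.injective hP hP0, hlim⟩

/-- Sign matrices are stable for the rotation flow, and attract the nearby orbits. -/
theorem frame_solution_stable {d : Fin k → ℝ} (hd : StrictAnti d) {s : Fin k → ℝ}
    (hs : IsSign s) {N : Set (Matrix (Fin k) (Fin k) ℝ)} (hN : N ∈ 𝓝 (Matrix.diagonal s)) :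
    ∃ N' ∈ 𝓝 (Matrix.diagonal s), ∀ O : ℝ → Matrix (Fin k) (Fin k) ℝ,
      (∀ t, O t ∈ Matrix.orthogonalGroup (Fin k) ℝ) →
      (∀ t, HasDerivAt O (frameField d (O t)) t) → O 0 ∈ N' →
      (∀ t, 0 ≤ t → O t ∈ N) ∧ Tendsto O atTop (𝓝 (Matrix.diagonal s)) := by
  obtain ⟨ρ, hρ, hρN⟩ := Metric.mem_nhds_iff.1 hN
  obtain ⟨r, hr, hrP⟩ := Metric.mem_nhds_iff.1
    ((finite_isSignedPermutation.subset
      (Set.sdiff_subset (t := {Matrix.diagonal s}))).isClosed.isOpen_compl.mem_nhds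
      (show Matrix.diagonal s ∈ ({P | IsSignedPermutation P} \ {Matrix.diagonal s})ᶜ by simp))
  have hiso : ∀ P, IsSignedPermutation P → dist P (Matrix.diagonal s) < r →
      P = Matrix.diagonal s := fun P hP hPr => by
    by_contra hne
    exact hrP hPr ⟨hP, hne⟩
  set ε := min (ρ / 2) (r / 2)
  have hε : 0 < ε := by positivity
  have hεr : ε < r := (min_le_right _ _).trans_lt (half_lt_self hr)
  have hερ : ε < ρ := (min_le_left _ _).trans_lt (half_lt_self hρ)
  obtain ⟨N', hN', hstay⟩ := exists_nhds_forall_dist_lt isCompact_orthogonalGroup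
    (continuous_frameEnergy d) (fun O hO => frameEnergy_nonneg d hO) (frameEnergy_diagonal d hs) hε
    (fun P hP hP0 hPε => by
      have := hiso P (isSignedPermutation_of_frameDissipation_eq_zero hd.injective hP
        (frameDissipation_eq_zero_of_frameEnergy_eq_zero hd.injective hP hP0)) (hPε.trans_lt hεr)
      rw [this, dist_self] at hPε
      exact hε.ne hPε)
  refine ⟨N', hN', fun O hO hO' h0 => ?_⟩
  have hanti : Antitone fun t => frameEnergy d (O t) := antitone_of_hasDerivAt_nonpos
    (fun t => hasDerivAt_frameEnergy hd (hO' t))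
    (fun t => neg_nonpos.2 (frameDissipation_nonneg d _))
  have hlt := hstay O (continuous_iff_continuousAt.2 fun t => (hO' t).continuousAt) hO
    (fun t ht => hanti ht) h0
  refine ⟨fun t ht => hρN ((hlt t ht).trans hερ), ?_⟩
  obtain ⟨P, hP, hlim⟩ := frame_solution_tendsto hd hO hO'
  -- The limit lies only in the closed ball; `ε < r` still leaves the sign matrix as the sole
  -- candidate.
  have hPle : dist P (Matrix.diagonal s) ≤ ε :=
    le_of_tendsto (hlim.dist tendsto_const_nhds)
      ((eventually_ge_atTop 0).mono fun t ht => (hlt t ht).le)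
  rwa [← hiso P hP (hPle.trans_lt hεr)]

end RotationFlow

/-! ### From rotation coordinates back to the RAG flow. -/

section Transport

variable {k m n : ℕ}

theorem ut_smul (c : ℝ) (M : Matrix (Fin k) (Fin k) ℝ) : ut (c • M) = c • ut M := by
  ext i j
  simp [ut]

theorem lt_smul (c : ℝ) (M : Matrix (Fin k) (Fin k) ℝ) : lt (c • M) = c • lt M := by
  ext i j
  simp [lt]

/-- On matrices `O Uᵀ` the RAG field is the rotation field in the coordinates `O`. -/
theorem ragField_mul_transpose {X : Matrix (Fin m) (Fin n) ℝ} {U : Matrix (Fin m) (Fin k) ℝ}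
    {d : Fin k → ℝ} (horth : Uᵀ * U = 1) (heig : cov X * U = U * Matrix.diagonal d)
    (O : Matrix (Fin k) (Fin k) ℝ) : ragField X (O * Uᵀ) = frameField d O * Uᵀ := by
  have hform : frameForm d O =
      (1 / (n : ℝ)) • (O * Uᵀ * X * Xᵀ * (O * Uᵀ)ᵀ) := by
    calc frameForm d O = O * (Uᵀ * (U * Matrix.diagonal d)) * Oᵀ := by
          rw [← Matrix.mul_assoc Uᵀ, horth, Matrix.one_mul, frameForm]
      _ = _ := by
          rw [← heig, cov]
          simp only [Matrix.transpose_mul, Matrix.transpose_transpose, Matrix.mul_assoc,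
            Matrix.smul_mul, Matrix.mul_smul]
  rw [ragField, frameField, frameGenerator, hform, ut_smul, lt_smul, ← smul_sub, smul_smul,
    Matrix.smul_mul, Matrix.smul_mul, Matrix.mul_assoc _ O]
  congr 1
  ring

open scoped Matrix.Norms.Elementwise

theorem isSolution_mul_transpose {X : Matrix (Fin m) (Fin n) ℝ} {U : Matrix (Fin m) (Fin k) ℝ}
    {d : Fin k → ℝ} (horth : Uᵀ * U = 1) (heig : cov X * U = U * Matrix.diagonal d)
    {O : ℝ → Matrix (Fin k) (Fin k) ℝ} (hO : ∀ t, HasDerivAt O (frameField d (O t)) t) :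
    IsSolution (ragField X) fun t => O t * Uᵀ := fun t _ => by
  have h := hasDerivAt_matrix_mul (hO t) (hasDerivAt_const t Uᵀ)
  rw [Matrix.mul_zero, add_zero, ← ragField_mul_transpose horth heig] at h
  exact h.hasDerivWithinAt

theorem isSolution_ragField_unique {X : Matrix (Fin m) (Fin n) ℝ}
    {V W : ℝ → Matrix (Fin k) (Fin m) ℝ} (hV : IsSolution (ragField X) V)
    (hW : IsSolution (ragField X) W) (h0 : V 0 = W 0) {t : ℝ} (ht : 0 ≤ t) : V t = W t :=
  IsSolution.unique (contDiff_ragField X) hV hW h0 ht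

end Transport

end RAG

theorem theorem4 {k m n : ℕ} (hkm : k < m) (X : Matrix (Fin m) (Fin n) ℝ)
    (σ : Fin k → ℝ) (U : Matrix (Fin m) (Fin k) ℝ) (hU : RAG.IsPrincipal hkm X σ U) :
    (∀ O₀ ∈ Matrix.orthogonalGroup (Fin k) ℝ,
      ∃ W : ℝ → Matrix (Fin k) (Fin m) ℝ,
        RAG.IsSolution (RAG.ragField X) W ∧ W 0 = O₀ * Uᵀ ∧
        (∀ W' : ℝ → Matrix (Fin k) (Fin m) ℝ,
          RAG.IsSolution (RAG.ragField X) W' → W' 0 = O₀ * Uᵀ → ∀ t, 0 ≤ t → W' t = W t) ∧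
        (∀ t, 0 ≤ t → W t ∈ RAG.orthogonalSet U) ∧
        ∃ P : Matrix (Fin k) (Fin k) ℝ, RAG.IsSignedPermutation P ∧
          Tendsto W atTop (𝓝 (P * Uᵀ))) ∧
    (∀ s : Fin k → ℝ, RAG.IsSign s →
      RAG.IsAsymptoticallyStable (RAG.ragField X) (RAG.orthogonalSet U)
        (Matrix.diagonal s * Uᵀ)) := by
  have horth := hU.orthonormal
  have heig := hU.eigenvector
  have hd : StrictAnti fun i => σ i ^ 2 := fun i j hij =>
    pow_lt_pow_left₀ (hU.strictAnti hij) (hU.pos j).le two_ne_zero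
  have hcont : Continuous fun O : Matrix (Fin k) (Fin k) ℝ => O * Uᵀ :=
    continuous_id.matrix_mul continuous_const
  -- Right multiplication by `U` recovers `O` from `O Uᵀ`, so neighbourhoods transfer in both
  -- directions.
  have hcont' : Continuous fun W : Matrix (Fin k) (Fin m) ℝ => W * U :=
    continuous_id.matrix_mul continuous_const
  have hUU : ∀ O : Matrix (Fin k) (Fin k) ℝ, O * Uᵀ * U = O := fun O => by
    rw [Matrix.mul_assoc, horth, Matrix.mul_one]
  refine ⟨fun O₀ h₀ => ?_, fun s hs => ?_⟩
  · obtain ⟨O, hO0, hO, hO'⟩ := RAG.exists_frame_solution (fun i => σ i ^ 2) h₀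
    obtain ⟨P, hP, hlim⟩ := RAG.frame_solution_tendsto hd hO hO'
    have hW := RAG.isSolution_mul_transpose horth heig hO'
    exact ⟨fun t => O t * Uᵀ, hW, by simp only [hO0],
      fun W' hW' h0 t ht => RAG.isSolution_ragField_unique hW' hW (by rw [h0, hO0]) ht,
      fun t _ => ⟨O t, hO t, rfl⟩, P, hP, (hcont.tendsto P).comp hlim⟩
  · have hstable : ∀ N ∈ 𝓝 (Matrix.diagonal s * Uᵀ), ∃ N' ∈ 𝓝 (Matrix.diagonal s * Uᵀ),
        ∀ x : ℝ → Matrix (Fin k) (Fin m) ℝ, RAG.IsSolution (RAG.ragField X) x →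
        x 0 ∈ RAG.orthogonalSet U → x 0 ∈ N' →
        (∀ t, 0 ≤ t → x t ∈ N) ∧ Tendsto x atTop (𝓝 (Matrix.diagonal s * Uᵀ)) := by
      intro N hN
      obtain ⟨N', hN', hstay⟩ := RAG.frame_solution_stable hd hs (hcont.tendsto _ hN)
      refine ⟨(fun W => W * U) ⁻¹' N', hcont'.tendsto _ (by rwa [hUU]), ?_⟩
      rintro x hx ⟨O₀, h₀, hx0⟩ hxN
      obtain ⟨O, hO0, hO, hO'⟩ := RAG.exists_frame_solution (fun i => σ i ^ 2) h₀
      -- Uniqueness in the full matrix space forces every solution starting in the orthogonal set to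
      -- be a transported rotation orbit.
      have hxO : ∀ t, 0 ≤ t → x t = O t * Uᵀ := fun t ht =>
        RAG.isSolution_ragField_unique hx (RAG.isSolution_mul_transpose horth heig hO')
          (by rw [hx0, hO0]) ht
      rw [Set.mem_preimage, hx0, hUU, ← hO0] at hxN
      obtain ⟨h1, h2⟩ := hstay O hO hO' hxN
      refine ⟨fun t ht => hxO t ht ▸ h1 t ht, ((hcont.tendsto _).comp h2).congr' ?_⟩
      exact (eventually_ge_atTop 0).mono fun t ht => (hxO t ht).symm
    exact
      { mem := ⟨_, RAG.diagonal_mem_orthogonalGroup hs, rfl⟩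
        equilibrium := by
          rw [RAG.ragField_mul_transpose horth heig, RAG.frameField_diagonal _ hs, Matrix.zero_mul]
        stable := fun N hN => by
          obtain ⟨N', hN', h⟩ := hstable N hN
          exact ⟨N', hN', fun x hx hxM hxN => (h x hx hxM hxN).1⟩
        attractive := by
          obtain ⟨N', hN', h⟩ := hstable Set.univ univ_mem
          exact ⟨N', hN', fun x hx hxM hxN => (h x hx hxM hxN).2⟩ }
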